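/- Let $E=\{1,\dots,L\}$, let $\Theta\subseteq 2^E$ be a non-empty family of feasible sets (solutions) such that every $e\in E$ lies in some $A\in\Theta$, let $K=\max_{A\in\Theta}|A|$, and let $P$ be a probability distribution on $[0,1]^E$ with mean vector $\bar w=\mathbb{E}_{w\sim P}[w]$. For $A\subseteq E$ and $u\in\mathbb{R}^E$ put $f(A,u)=\sum_{e\in A}u(e)$. Let $A^\ast\in\Theta$ maximize $f(\cdot,\bar w)$ over $\Theta$, and let $\Delta_A=f(A^\ast,\bar w)-f(A,\bar w)$. Let an oracle be given: a fixed measurable map that sends each $u\in\mathbb{R}^E$ to some element of $\operatorname{argmax}_{A\in\Theta}f(A,u)$. Let $w_1,w_2,\dots$ be i.i.d. with law $P$. The algorithm CombUCB1 chooses $A_t\in\Theta$ at each time $t\ge1$ and then observes $w_t(e)$ for $e\in A_t$, as follows. *Initialization.* Start with $u(e)=1$ and $\hat w(e)=0$ for all $e\in E$. As long as $u(e)=1$ for some $e$, let $A_t$ be the oracle's answer on $u$, and then set $\hat w(e)\leftarrow w_t(e)$ and $u(e)\leftarrow0$ for all $e\in A_t$. Let $t_0$ be the first time after this phase, and put $T_{t_0-1}(e)=1$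 for all $e$. *Main phase.* For $t\ge t_0$, let $A_t$ be the oracle's answer on the vector $U_t$ given by $$U_t(e)=\hat w(e)+\sqrt{\frac{1.5\,\log(t-1)}{T_{t-1}(e)}},$$ where $\hat w$ is the current estimate. Then set $\hat w(e)\leftarrow\frac{T_{t-1}(e)\hat w(e)+w_t(e)}{T_{t-1}(e)+1}$ and $T_t(e)=T_{t-1}(e)+1$ for $e\in A_t$; for $e\notin A_t$, $\hat w(e)$ does not change and $T_t(e)=T_{t-1}(e)$. **Theorem.** Let $\Delta>0$, and suppose that $\Delta_A=\Delta$ for every suboptimal solution, that is, for every $A\in\Theta$ with $\Delta_A>0$. Then for every $n\ge0$ (with the convention $\log 0=0$) the cumulative regret $\sum_{t=1}^n\bigl(f(A^\ast,w_t)-f(A_t,w_t)\bigr)$ of CombUCB1 is integrable, and its expectation $R(n)$ satisfies $$R(n)\le K^{4/3}L\,\frac{48}{\Delta}\log n+\left(\frac{\pi^2}{3}+1\right)KL .$$ -/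

import Mathlib

open MeasureTheory ProbabilityTheory

noncomputable section

/-- The return `f(A, w)`: the sum of the weights of the items in `A`. -/
def payoff {L : ℕ} (A : Finset (Fin L)) (w : Fin L → ℝ) : ℝ :=
  ∑ e ∈ A, w e

/-- A stochastic combinatorial semi-bandit `(E, Θ, P)` with ground set `E = Fin L`, a nonempty
family `Θ` of feasible subsets, and a probability distribution `P` over the cube `[0, 1]^E`. -/
structure SemiBandit (L : ℕ) where
  feasible : Finset (Finset (Fin L))
  feasible_nonempty : feasible.Nonempty
  P : Measure (Fin L → ℝ)
  isProbabilityMeasure : IsProbabilityMeasure P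
  mem_cube : ∀ᵐ w ∂P, ∀ e, w e ∈ Set.Icc (0 : ℝ) 1

namespace SemiBandit

/-- The expected weights of the items. -/
def mean {L : ℕ} (B : SemiBandit L) (e : Fin L) : ℝ :=
  ∫ w, w e ∂B.P

/-- `K`, the maximum number of chosen items. -/
def maxCard {L : ℕ} (B : SemiBandit L) : ℕ :=
  B.feasible.sup Finset.card

/-- `A` is a solution that maximizes the expected return. -/
def IsOptimal {L : ℕ} (B : SemiBandit L) (A : Finset (Fin L)) : Prop :=
  A ∈ B.feasible ∧ ∀ A' ∈ B.feasible, payoff A' B.mean ≤ payoff A B.mean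

/-- The gap of solution `A` relative to the optimal solution `Astar`. -/
def gap {L : ℕ} (B : SemiBandit L) (Astar A : Finset (Fin L)) : ℝ :=
  payoff Astar B.mean - payoff A B.mean

end SemiBandit

/-- `oracle` is an offline optimization oracle for the feasible set `Θ`: it maps every weight
vector `u` to some maximizer of `f(·, u)` over `Θ` (ties are broken arbitrarily but measurably). -/
structure IsOracle {L : ℕ} (Θ : Finset (Finset (Fin L)))
    (oracle : (Fin L → ℝ) → Finset (Fin L)) : Prop where
  mem : ∀ u, oracle u ∈ Θ
  payoff_le : ∀ u, ∀ A ∈ Θ, payoff A u ≤ payoff (oracle u) u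
  measurableSet_eq : ∀ A, MeasurableSet {u | oracle u = A}

namespace CombUCB1

/-- The radius `c_{t,s}` of the confidence interval. -/
def radius (t s : ℕ) : ℝ :=
  Real.sqrt (1.5 * Real.log t / s)

/-- The variables of the algorithm: the auxiliary weights `u` of the initialization, the
estimates `est` of the expected weights, and the observation counters `count`. -/
structure State (L : ℕ) where
  u : Fin L → ℝ
  est : Fin L → ℝ
  count : Fin L → ℕ

/-- The starting state. The counters are not touched during the initialization, so that all of
them are equal to `1` when it ends. -/
def State.start (L : ℕ) : State L where
  u := fun _ => 1
  est := fun _ => 0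
  count := fun _ => 1

/-- The algorithm is still in its initialization loop. -/
def State.InInit {L : ℕ} (s : State L) : Prop :=
  ∃ e, s.u e = 1

/-- The upper confidence bounds used at time `t + 1`, when `t` steps are complete. -/
def State.ucb {L : ℕ} (s : State L) (t : ℕ) (e : Fin L) : ℝ :=
  s.est e + radius t (s.count e)

open Classical in
/-- The solution chosen at time `t + 1` from the state `s` after `t` steps. -/
def State.choice {L : ℕ} (oracle : (Fin L → ℝ) → Finset (Fin L)) (s : State L) (t : ℕ) :
    Finset (Fin L) :=
  if s.InInit then oracle s.u else oracle (s.ucb t)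

open Classical in
/-- The update of the state `s` at time `t + 1`, when the realized weights are `w`; only the
weights of the chosen items are used. -/
def State.step {L : ℕ} (oracle : (Fin L → ℝ) → Finset (Fin L)) (s : State L) (t : ℕ)
    (w : Fin L → ℝ) : State L :=
  if s.InInit then
    { u := fun e => if e ∈ s.choice oracle t then 0 else s.u e
      est := fun e => if e ∈ s.choice oracle t then w e else s.est e
      count := s.count }
  else
    { u := s.u
      est := fun e =>
        if e ∈ s.choice oracle t then (s.count e * s.est e + w e) / (s.count e + 1) else s.est e
      count := fun e => if e ∈ s.choice oracle t then s.count e + 1 else s.count e }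

/-- The state after `t` steps, when `w t` is the realization of the weights at time `t ≥ 1`
(the entry `w 0` is not used). -/
def state {L : ℕ} (oracle : (Fin L → ℝ) → Finset (Fin L)) (w : ℕ → Fin L → ℝ) : ℕ → State L
  | 0 => State.start L
  | t + 1 => (state oracle w t).step oracle t (w (t + 1))

/-- The solution `A_{t + 1}` chosen at time `t + 1`. -/
def nextSolution {L : ℕ} (oracle : (Fin L → ℝ) → Finset (Fin L)) (w : ℕ → Fin L → ℝ) (t : ℕ) :
    Finset (Fin L) :=
  (state oracle w t).choice oracle t

/-- The realized cumulative regret over the times `1, …, n`. -/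
def cumulativeRegret {L : ℕ} (oracle : (Fin L → ℝ) → Finset (Fin L)) (Astar : Finset (Fin L))
    (w : ℕ → Fin L → ℝ) (n : ℕ) : ℝ :=
  ∑ t ∈ Finset.range n,
    (payoff Astar (w (t + 1)) - payoff (nextSolution oracle w t) (w (t + 1)))

end CombUCB1

end

namespace CombUCB1

variable {L : ℕ} {orc : (Fin L → ℝ) → Finset (Fin L)}

/-! ### Deterministic properties of the algorithm -/

/-! The choice at time `t + 1` depends only on earlier weights, so the expected regret is the
expected sum of gaps (`integral_cumulativeRegret`). There are three kinds of times. Initialization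
lasts at most `L` steps, each costing at most `K`.

At a main-phase time when all estimates lie in their confidence intervals, optimism gives `Δ ≤ 2 ∑
radius` for a suboptimal choice. Items observed more than `M = 24 K² log n / Δ²` times supply at
most `Δ / 2` of this, so the other items supply the rest: `Δ ≤ 4 √(1.5 log n) ∑ 1 / √count`. Each
counter passes each value at most once, and `∑_{s ≤ M} 1 / √s ≤ 2 √M`, so these times cost at most
`48 K L log n / Δ` on every path (`sum_gap_concentrated_le`). This is linear in `K`, hence within
the claimed power.

At the remaining times an estimate has left its interval. The process `expProcess` has expectation
at most `1` although the observation times are random; Markov's inequality and a union bound over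
items, signs and counter values give probability at most `2L / t²`. Summation over `t` yields `π² /
3`. -/

theorem step_of_inInit {s : State L} (h : s.InInit) (t : ℕ) (v : Fin L → ℝ) :
    s.step orc t v =
      { u := fun e => if e ∈ s.choice orc t then 0 else s.u e
        est := fun e => if e ∈ s.choice orc t then v e else s.est e
        count := s.count } := by
  simp [State.step, h]

theorem step_of_not_inInit {s : State L} (h : ¬ s.InInit) (t : ℕ) (v : Fin L → ℝ) :
    s.step orc t v =
      { u := s.u
        est := fun e =>
          if e ∈ s.choice orc t then (s.count e * s.est e + v e) / (s.count e + 1) else s.est e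
        count := fun e => if e ∈ s.choice orc t then s.count e + 1 else s.count e } := by
  simp [State.step, h]

theorem choice_of_inInit {s : State L} (h : s.InInit) (t : ℕ) :
    s.choice orc t = orc s.u := by
  simp [State.choice, h]

theorem choice_of_not_inInit {s : State L} (h : ¬ s.InInit) (t : ℕ) :
    s.choice orc t = orc (s.ucb t) := by
  simp [State.choice, h]

/-- The auxiliary weights of the initialization do not depend on the realized weights. -/
theorem state_u_congr (w w' : ℕ → Fin L → ℝ) (t : ℕ) :
    (state orc w t).u = (state orc w' t).u := by
  induction t with
  | zero => rfl
  | succ t ih =>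
    by_cases h : (state orc w t).InInit
    · have h' : (state orc w' t).InInit := by simpa [State.InInit, ih] using h
      simp only [state, step_of_inInit h, step_of_inInit h', choice_of_inInit h,
        choice_of_inInit h', ih]
    · have h' : ¬ (state orc w' t).InInit := by simpa [State.InInit, ih] using h
      simp only [state, step_of_not_inInit h, step_of_not_inInit h', ih]

theorem inInit_congr (w w' : ℕ → Fin L → ℝ) (t : ℕ) :
    (state orc w t).InInit ↔ (state orc w' t).InInit := by
  simp only [State.InInit, state_u_congr w w' t]

theorem state_u_eq_zero_or_one (w : ℕ → Fin L → ℝ) (t : ℕ) (e : Fin L) :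
    (state orc w t).u e = 0 ∨ (state orc w t).u e = 1 := by
  induction t with
  | zero => exact Or.inr rfl
  | succ t ih =>
    by_cases h : (state orc w t).InInit
    · simp only [state, step_of_inInit h]
      split_ifs
      · exact Or.inl rfl
      · exact ih
    · simpa only [state, step_of_not_inInit h] using ih

theorem count_of_inInit (w : ℕ → Fin L → ℝ) (t : ℕ) (h : (state orc w t).InInit) :
    (state orc w t).count = fun _ => 1 := by
  induction t with
  | zero => rfl
  | succ t ih =>
    by_cases h' : (state orc w t).InInit
    · simpa only [state, step_of_inInit h'] using ih h'
    · exfalso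
      apply h'
      simpa only [state, step_of_not_inInit h', State.InInit] using h

theorem inInit_zero (w : ℕ → Fin L → ℝ) (e : Fin L) : (state orc w 0).InInit :=
  ⟨e, rfl⟩

theorem one_le_count (w : ℕ → Fin L → ℝ) (t : ℕ) (e : Fin L) :
    1 ≤ (state orc w t).count e := by
  induction t with
  | zero => exact le_rfl
  | succ t ih =>
    by_cases h : (state orc w t).InInit
    · simpa only [state, step_of_inInit h] using ih
    · simp only [state, step_of_not_inInit h]
      split_ifs <;> omega

/-- Counters start at `1`, but the first step belongs to the initialization and leaves them alone.
The bound limits the later union bound to `t + 1` counter values. -/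
theorem count_succ_le (w : ℕ → Fin L → ℝ) (t : ℕ) (e : Fin L) :
    (state orc w (t + 1)).count e ≤ t + 1 := by
  induction t with
  | zero =>
    have h := inInit_zero (orc := orc) w e
    rw [state, step_of_inInit h, count_of_inInit w 0 h]
  | succ t ih =>
    rw [state]
    by_cases h : (state orc w (t + 1)).InInit
    · rw [step_of_inInit h]
      exact ih.trans (Nat.le_succ _)
    · rw [step_of_not_inInit h]
      dsimp only
      split_ifs <;> omega

open Classical in
/-- The initialization takes at most `L` steps. -/
theorem card_inInit_le {Θ : Finset (Finset (Fin L))} (horacle : IsOracle Θ orc)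
    (hcover : ∀ e : Fin L, ∃ A ∈ Θ, e ∈ A) (w : ℕ → Fin L → ℝ) (n : ℕ) :
    ((Finset.range n).filter fun t => (state orc w t).InInit).card ≤ L := by
  -- Potential argument: each initialization step lowers the number of items of auxiliary weight
  -- `1`.
  suffices h : ((Finset.range n).filter fun t => (state orc w t).InInit).card +
      (Finset.univ.filter fun e => (state orc w n).u e = 1).card ≤ L by omega
  induction n with
  | zero => simpa using Finset.card_filter_le (Finset.univ : Finset (Fin L)) _
  | succ n ih =>
    rw [Finset.range_add_one, Finset.filter_insert]
    by_cases h : (state orc w n).InInit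
    · rw [if_pos h, Finset.card_insert_of_notMem (by simp)]
      have hlt : (Finset.univ.filter fun e => (state orc w (n + 1)).u e = 1).card <
          (Finset.univ.filter fun e => (state orc w n).u e = 1).card := by
        apply Finset.card_lt_card
        obtain ⟨e₀, he₀⟩ := id h
        obtain ⟨A, hA, heA⟩ := hcover e₀
        have hnn : ∀ e, 0 ≤ (state orc w n).u e := fun e => by
          rcases state_u_eq_zero_or_one (orc := orc) w n e with h | h <;> rw [h]
          exact zero_le_one
        -- A feasible set covering `e₀` is worth at least `1`, so the oracle's answer must contain
        -- an item of nonzero weight.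
        have h1 : 1 ≤ payoff A (state orc w n).u := by
          rw [← he₀]
          exact Finset.single_le_sum (f := (state orc w n).u) (fun e _ => hnn e) heA
        have h2 := h1.trans (horacle.payoff_le (state orc w n).u A hA)
        obtain ⟨e₁, he₁, hne⟩ : ∃ e ∈ orc (state orc w n).u, (state orc w n).u e ≠ 0 := by
          by_contra! hcon
          have : payoff (orc (state orc w n).u) (state orc w n).u = 0 :=
            Finset.sum_eq_zero hcon
          linarith
        have hone := (state_u_eq_zero_or_one w n e₁).resolve_left hne
        rw [Finset.ssubset_iff_of_subset]
        · refine ⟨e₁, by simp [hone], ?_⟩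
          simp [state, step_of_inInit h, choice_of_inInit h, he₁]
        · intro e
          simp only [state, step_of_inInit h, Finset.mem_filter, Finset.mem_univ, true_and]
          split_ifs <;> simp
      omega
    · rw [if_neg h]
      simpa only [state, step_of_not_inInit h] using ih

theorem nextSolution_mem {Θ : Finset (Finset (Fin L))} (horacle : IsOracle Θ orc)
    (w : ℕ → Fin L → ℝ) (t : ℕ) : nextSolution orc w t ∈ Θ := by
  unfold nextSolution State.choice
  split_ifs <;> exact horacle.mem _

open Classical in
/-- Each counter takes every value at most once at the times at which its item is chosen. -/
theorem sum_count_eq (g : ℕ → ℝ) (w : ℕ → Fin L → ℝ) (e : Fin L) (n : ℕ) :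
    (∑ t ∈ Finset.range n,
      if ¬ (state orc w t).InInit ∧ e ∈ nextSolution orc w t then
        g ((state orc w t).count e) else 0) =
      ∑ s ∈ Finset.Ico 1 ((state orc w n).count e), g s := by
  induction n with
  | zero => simp [state, State.start]
  | succ n ih =>
    rw [Finset.sum_range_succ, ih]
    by_cases h : (state orc w n).InInit
    · simp [state, step_of_inInit h, h]
    · by_cases he : e ∈ nextSolution orc w n
      · rw [if_pos ⟨h, he⟩]
        have : (state orc w (n + 1)).count e = (state orc w n).count e + 1 := by
          rw [nextSolution] at he
          simp [state, step_of_not_inInit h, he]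
        rw [this, Finset.sum_Ico_succ_top (one_le_count w n e)]
      · rw [if_neg (fun h => he h.2), add_zero]
        rw [nextSolution] at he
        simp [state, step_of_not_inInit h, he]

/-- Telescoping of `1 / √(k + 1) ≤ 2 (√(k + 1) - √k)`. -/
theorem sum_inv_sqrt_le (k : ℕ) :
    ∑ s ∈ Finset.Ico 1 (k + 1), 1 / Real.sqrt s ≤ 2 * Real.sqrt k := by
  induction k with
  | zero => simp
  | succ k ih =>
    rw [Finset.sum_Ico_succ_top (by omega)]
    have hk : (0 : ℝ) < Real.sqrt ((k + 1 : ℕ) : ℝ) := Real.sqrt_pos.2 (by positivity)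
    have h1 := Real.sq_sqrt (show (0 : ℝ) ≤ ((k + 1 : ℕ) : ℝ) by positivity)
    have h2 := Real.sq_sqrt (show (0 : ℝ) ≤ (k : ℝ) by positivity)
    have h3 : 1 / Real.sqrt ((k + 1 : ℕ) : ℝ) ≤
        2 * Real.sqrt ((k + 1 : ℕ) : ℝ) - 2 * Real.sqrt k := by
      rw [div_le_iff₀ hk]
      push_cast at h1 ⊢
      nlinarith [sq_nonneg (Real.sqrt ((k : ℝ) + 1) - Real.sqrt k)]
    linarith

open Classical in
theorem sum_truncated_inv_sqrt_le {M : ℝ} (hM : 0 ≤ M) (N : ℕ) :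
    (∑ s ∈ Finset.Ico 1 N, if (s : ℝ) ≤ M then 1 / Real.sqrt s else 0) ≤ 2 * Real.sqrt M := by
  rw [← Finset.sum_filter]
  calc _ ≤ ∑ s ∈ Finset.Ico 1 (⌊M⌋₊ + 1), 1 / Real.sqrt s := by
        apply Finset.sum_le_sum_of_subset_of_nonneg
        · intro s hs
          simp only [Finset.mem_filter, Finset.mem_Ico] at hs ⊢
          exact ⟨hs.1.1, Nat.lt_succ_of_le (Nat.le_floor hs.2)⟩
        · intros
          positivity
    _ ≤ 2 * Real.sqrt ⌊M⌋₊ := sum_inv_sqrt_le _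
    _ ≤ 2 * Real.sqrt M := by
        gcongr
        exact Nat.floor_le hM

/-! ### Optimism and the pathwise gap bound -/

theorem radius_nonneg (t s : ℕ) : 0 ≤ radius t s := Real.sqrt_nonneg _

/-- All the estimates lie in their confidence intervals at time `t + 1`. -/
def Concentrated (orc : (Fin L → ℝ) → Finset (Fin L)) (m : Fin L → ℝ) (w : ℕ → Fin L → ℝ)
    (t : ℕ) : Prop :=
  ∀ e, |(state orc w t).est e - m e| ≤ radius t ((state orc w t).count e)

/-- Optimism: inside the intervals an upper confidence bound exceeds the mean by between zero and
two radii, and the oracle ranks its choice at least as high as `A`. -/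
theorem payoff_sub_le_of_concentrated {Θ : Finset (Finset (Fin L))}
    (horacle : IsOracle Θ orc) {m : Fin L → ℝ} {w : ℕ → Fin L → ℝ} {t : ℕ}
    (hinit : ¬ (state orc w t).InInit) (hconc : Concentrated orc m w t)
    {A : Finset (Fin L)} (hA : A ∈ Θ) :
    payoff A m - payoff (nextSolution orc w t) m ≤
      2 * ∑ e ∈ nextSolution orc w t, radius t ((state orc w t).count e) := by
  have hmax : payoff A ((state orc w t).ucb t) ≤
      payoff (nextSolution orc w t) ((state orc w t).ucb t) := by
    rw [nextSolution, choice_of_not_inInit hinit]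
    exact horacle.payoff_le _ A hA
  have hlow : payoff A m ≤ payoff A ((state orc w t).ucb t) := by
    refine Finset.sum_le_sum fun e _ => ?_
    have := (abs_le.1 (hconc e)).1
    simp only [State.ucb]
    linarith
  have hup : payoff (nextSolution orc w t) ((state orc w t).ucb t) ≤
      payoff (nextSolution orc w t) m +
        2 * ∑ e ∈ nextSolution orc w t, radius t ((state orc w t).count e) := by
    rw [Finset.mul_sum, payoff, payoff, ← Finset.sum_add_distrib]
    refine Finset.sum_le_sum fun e _ => ?_
    have := (abs_le.1 (hconc e)).2
    simp only [State.ucb]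
    linarith
  linarith

/-- The threshold constant is `24 = 1.5 · 16`, which makes `K² radius²` at most `Δ² / 16`. -/
theorem card_mul_radius_le {Δ : ℝ} (hΔ : 0 < Δ) {K n t s : ℕ} (hs : 1 ≤ s) (ht : t ≤ n)
    (hM : 24 * (K : ℝ) ^ 2 * Real.log n / Δ ^ 2 ≤ s) : K * radius t s ≤ Δ / 4 := by
  have hs' : (0 : ℝ) < s := by exact_mod_cast hs
  have hlog : Real.log t ≤ Real.log n := by
    rcases Nat.eq_zero_or_pos t with rfl | h
    · simpa using Real.log_natCast_nonneg n
    · exact Real.log_le_log (by exact_mod_cast h) (by exact_mod_cast ht)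
  rw [div_le_iff₀ (by positivity)] at hM
  rw [radius, ← abs_of_nonneg (Nat.cast_nonneg K : (0 : ℝ) ≤ K), ← Real.sqrt_sq_eq_abs,
    ← Real.sqrt_mul (sq_nonneg _)]
  apply Real.sqrt_le_iff.2 ⟨by positivity, ?_⟩
  rw [mul_div_assoc', div_le_iff₀ hs']
  nlinarith [mul_le_mul_of_nonneg_left hlog (sq_nonneg (K : ℝ))]

open Classical in
/-- The number of observations after which a confidence interval is too short to matter is at
most quadratic in the size of the solutions. -/
theorem le_sum_truncated {Δ : ℝ} (hΔ : 0 < Δ) {K n t : ℕ} (ht : t ≤ n) (c : Fin L → ℕ)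
    (hc : ∀ e, 1 ≤ c e) (A : Finset (Fin L)) (hA : A.card ≤ K)
    (h : Δ ≤ 2 * ∑ e ∈ A, radius t (c e)) :
    Δ ≤ 4 * Real.sqrt (1.5 * Real.log n) * ∑ e ∈ A,
      if (c e : ℝ) ≤ 24 * (K : ℝ) ^ 2 * Real.log n / Δ ^ 2 then 1 / Real.sqrt (c e) else 0 := by
  -- Multiplying by `K` postpones the division. The extra `Δ / 4`, summed over at most `K` items and
  -- divided by `K`, is doubled to `Δ / 2` and absorbed on the left.
  have hterm : ∀ e ∈ A, (K : ℝ) * radius t (c e) ≤ K * (Real.sqrt (1.5 * Real.log n) *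
      if (c e : ℝ) ≤ 24 * (K : ℝ) ^ 2 * Real.log n / Δ ^ 2 then 1 / Real.sqrt (c e) else 0) +
        Δ / 4 := by
    intro e _
    split_ifs with hle
    · have hlog : Real.log t ≤ Real.log n := by
        rcases Nat.eq_zero_or_pos t with rfl | h
        · simpa using Real.log_natCast_nonneg n
        · exact Real.log_le_log (by exact_mod_cast h) (by exact_mod_cast ht)
      have : radius t (c e) ≤ Real.sqrt (1.5 * Real.log n) * (1 / Real.sqrt (c e)) := by
        rw [mul_one_div, ← Real.sqrt_div' _ (Nat.cast_nonneg _), radius]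
        gcongr
      have := mul_le_mul_of_nonneg_left this (Nat.cast_nonneg K : (0 : ℝ) ≤ K)
      linarith
    · have := card_mul_radius_le hΔ (hc e) ht (not_le.1 hle).le
      linarith
  have hsum := Finset.sum_le_sum hterm
  rw [← Finset.mul_sum, Finset.sum_add_distrib, ← Finset.mul_sum, ← Finset.mul_sum,
    Finset.sum_const, nsmul_eq_mul] at hsum
  have hAK : (A.card : ℝ) ≤ K := by exact_mod_cast hA
  rcases Nat.eq_zero_or_pos K with rfl | hK
  · have : A = ∅ := Finset.card_eq_zero.1 (Nat.le_zero.1 hA)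
    subst this
    simp at h
    linarith
  · have hK' : (0 : ℝ) < K := by exact_mod_cast hK
    have h1 : (A.card : ℝ) * (Δ / 4) ≤ K * (Δ / 4) := by gcongr
    have h2 := hsum.trans (add_le_add le_rfl h1)
    rw [← mul_add] at h2
    have h3 := le_of_mul_le_mul_left h2 hK'
    linarith

open Classical in
/-- The total gap of the choices made in the main phase while all the estimates are in their
confidence intervals. -/
theorem sum_gap_concentrated_le (B : SemiBandit L) {Astar : Finset (Fin L)}
    (hstar : Astar ∈ B.feasible) {Δ : ℝ} (hΔ : 0 < Δ)
    (hgap : ∀ A ∈ B.feasible, 0 < B.gap Astar A → B.gap Astar A = Δ)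
    (horacle : IsOracle B.feasible orc) (w : ℕ → Fin L → ℝ) (n : ℕ) :
    (∑ t ∈ Finset.range n,
      if ¬ (state orc w t).InInit ∧ Concentrated orc B.mean w t then
        B.gap Astar (nextSolution orc w t) else 0) ≤
      48 * B.maxCard * L * Real.log n / Δ := by
  set M : ℝ := 24 * (B.maxCard : ℝ) ^ 2 * Real.log n / Δ ^ 2 with hMdef
  have hlog : 0 ≤ Real.log n := Real.log_natCast_nonneg n
  have hM : 0 ≤ M := by positivity
  let g : ℕ → ℝ := fun s => if (s : ℝ) ≤ M then 1 / Real.sqrt s else 0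
  have hg : ∀ s, 0 ≤ g s := fun s => by
    simp only [g]
    split_ifs <;> positivity
  calc _ ≤ ∑ t ∈ Finset.range n, 4 * Real.sqrt (1.5 * Real.log n) * ∑ e,
        if ¬ (state orc w t).InInit ∧ e ∈ nextSolution orc w t then
          g ((state orc w t).count e) else 0 := by
        refine Finset.sum_le_sum fun t ht => ?_
        have hnn : (0 : ℝ) ≤ 4 * Real.sqrt (1.5 * Real.log n) * ∑ e,
            if ¬ (state orc w t).InInit ∧ e ∈ nextSolution orc w t then
              g ((state orc w t).count e) else 0 := by
          refine mul_nonneg (by positivity) (Finset.sum_nonneg fun e _ => ?_)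
          split_ifs
          · exact hg _
          · exact le_rfl
        split_ifs with h
        · rcases le_or_gt (B.gap Astar (nextSolution orc w t)) 0 with h0 | h0
          · exact h0.trans hnn
          · have hmem := nextSolution_mem horacle w t
            have heq := hgap _ hmem h0
            have hle := heq.symm.le.trans
              (payoff_sub_le_of_concentrated horacle h.1 h.2 hstar)
            have := le_sum_truncated hΔ (Finset.mem_range.1 ht).le _
              (fun e => one_le_count (orc := orc) w t e) _
              (Finset.le_sup (f := Finset.card) hmem) hle
            rw [heq]
            refine this.trans_eq ?_
            congr 1
            simp only [h.1, not_false_eq_true, true_and]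
            rw [Finset.sum_ite_mem, Finset.univ_inter]
            rfl
        · exact hnn
    _ = 4 * Real.sqrt (1.5 * Real.log n) * ∑ e : Fin L,
          ∑ s ∈ Finset.Ico 1 ((state orc w n).count e), g s := by
        rw [← Finset.mul_sum, Finset.sum_comm]
        simp only [sum_count_eq]
    _ ≤ 4 * Real.sqrt (1.5 * Real.log n) * ∑ _e : Fin L, 2 * Real.sqrt M := by
        gcongr with e
        exact sum_truncated_inv_sqrt_le hM _
    _ = 8 * L * Real.sqrt (1.5 * Real.log n * M) := by
        rw [Real.sqrt_mul (x := 1.5 * Real.log n) (by positivity), Finset.sum_const,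
          Finset.card_univ, Fintype.card_fin, nsmul_eq_mul]
        ring
    _ = 48 * B.maxCard * L * Real.log n / Δ := by
        -- A perfect square, as `1.5 · 24 = 6²`; hence the constant `8 · 6 = 48`.
        have : 1.5 * Real.log n * M = (6 * B.maxCard * Real.log n / Δ) ^ 2 := by
          rw [hMdef]
          field_simp
          ring
        rw [this, Real.sqrt_sq (by positivity)]
        ring

end CombUCB1

/-! ### Moments of a single observation -/

namespace SemiBandit

variable {L : ℕ} (B : SemiBandit L)

theorem integrable_eval (e : Fin L) : Integrable (fun v : Fin L → ℝ => v e) B.P := by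
  have := B.isProbabilityMeasure
  exact Integrable.of_mem_Icc 0 1 (measurable_pi_apply e).aemeasurable
    (B.mem_cube.mono fun v hv => hv e)

theorem mean_mem_Icc (e : Fin L) : B.mean e ∈ Set.Icc (0 : ℝ) 1 := by
  have := B.isProbabilityMeasure
  refine ⟨integral_nonneg_of_ae (B.mem_cube.mono fun v hv => (hv e).1), ?_⟩
  calc B.mean e ≤ ∫ _, (1 : ℝ) ∂B.P :=
        integral_mono_ae (B.integrable_eval e) (integrable_const _)
          (B.mem_cube.mono fun v hv => (hv e).2)
    _ = 1 := by simp

theorem gap_le_maxCard {Astar : Finset (Fin L)} (hstar : Astar ∈ B.feasible)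
    (A : Finset (Fin L)) : B.gap Astar A ≤ B.maxCard := by
  have h1 : payoff Astar B.mean ≤ Astar.card := by
    rw [← nsmul_one]
    exact Finset.sum_le_card_nsmul Astar B.mean 1 fun e _ => (B.mean_mem_Icc e).2
  have h2 : 0 ≤ payoff A B.mean := Finset.sum_nonneg fun e _ => (B.mean_mem_Icc e).1
  have h3 : (Astar.card : ℝ) ≤ B.maxCard := by
    exact_mod_cast Finset.le_sup (f := Finset.card) hstar
  unfold gap
  linarith

theorem integral_payoff (A : Finset (Fin L)) : ∫ v, payoff A v ∂B.P = payoff A B.mean := by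
  unfold payoff
  rw [integral_finsetSum _ fun e _ => B.integrable_eval e]
  rfl

/-- Hoeffding's lemma: a variable in `[0, 1]` is sub-Gaussian with variance proxy `1 / 4`. -/
theorem lintegral_exp_le_one (e : Fin L) (lam : ℝ) :
    ∫⁻ v, ENNReal.ofReal (Real.exp (lam * (v e - B.mean e) - lam ^ 2 / 8)) ∂B.P ≤ 1 := by
  have := B.isProbabilityMeasure
  have hsub : HasSubgaussianMGF (fun v : Fin L → ℝ => v e - B.mean e) _ B.P := hasSubgaussianMGF_of_mem_Icc (μ := B.P) (X := fun v : Fin L → ℝ => v e)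
    (a := 0) (b := 1) (measurable_pi_apply e).aemeasurable (B.mem_cube.mono fun v hv => hv e)
  have hint := hsub.integrable_exp_mul lam
  have hle := hsub.mgf_le lam
  simp only [Real.exp_sub _ (lam ^ 2 / 8)]
  rw [← ofReal_integral_eq_lintegral_ofReal (hint.div_const _)
    (Filter.Eventually.of_forall fun v => by positivity), integral_div, ENNReal.ofReal_le_one,
    div_le_one (Real.exp_pos _)]
  refine hle.trans_eq ?_
  congr 1
  norm_num
  ring

end SemiBandit

namespace CombUCB1

variable {L : ℕ} {orc : (Fin L → ℝ) → Finset (Fin L)} {Ω : Type*}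

/-! ### Measurability -/

theorem measurableSet_mem_nextSolution [MeasurableSpace Ω] {w : ℕ → Ω → Fin L → ℝ} {t : ℕ}
    (h : ∀ A, MeasurableSet {ω | nextSolution orc (fun i => w i ω) t = A}) (e : Fin L) :
    MeasurableSet {ω | e ∈ nextSolution orc (fun i => w i ω) t} := by
  classical
  have : {ω | e ∈ nextSolution orc (fun i => w i ω) t} =
      ⋃ A ∈ Finset.univ.filter fun A : Finset (Fin L) => e ∈ A,
        {ω | nextSolution orc (fun i => w i ω) t = A} := by
    ext ω
    simp
  rw [this]
  exact Finset.measurableSet_biUnion _ fun A _ => h A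

theorem measurableSet_nextSolution_eq_of_state {Θ : Finset (Finset (Fin L))}
    (horacle : IsOracle Θ orc) [MeasurableSpace Ω] {w : ℕ → Ω → Fin L → ℝ} {t : ℕ}
    (hest : ∀ e, Measurable fun ω => (state orc (fun i => w i ω) t).est e)
    (hcount : ∀ e, Measurable fun ω => (state orc (fun i => w i ω) t).count e)
    (A : Finset (Fin L)) :
    MeasurableSet {ω | nextSolution orc (fun i => w i ω) t = A} := by
  -- The phase at time `t` is deterministic, so the zero realization decides it for every `ω`.
  by_cases h : (state orc (0 : ℕ → Fin L → ℝ) t).InInit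
  · have h' := fun ω => (inInit_congr (orc := orc) (fun i => w i ω) 0 t).2 h
    simp only [nextSolution, choice_of_inInit (h' _),
      fun ω => state_u_congr (orc := orc) (fun i => w i ω) 0 t]
    exact MeasurableSet.const _
  · have h' := fun ω => mt (inInit_congr (orc := orc) (fun i => w i ω) 0 t).1 h
    simp only [nextSolution, choice_of_not_inInit (h' _)]
    have hucb : Measurable fun ω => (state orc (fun i => w i ω) t).ucb t := by
      refine measurable_pi_lambda _ fun e => (hest e).add ?_
      exact (measurable_from_top (f := radius t)).comp (hcount e)
    exact hucb (horacle.measurableSet_eq A)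

theorem measurable_state {Θ : Finset (Finset (Fin L))} (horacle : IsOracle Θ orc)
    {mΩ : MeasurableSpace Ω} (ℱ : Filtration ℕ mΩ) {w : ℕ → Ω → Fin L → ℝ}
    (hw : ∀ t, Measurable[ℱ t] (w t)) (t : ℕ) :
    (∀ e, Measurable[ℱ t] fun ω => (state orc (fun i => w i ω) t).est e) ∧
      ∀ e, Measurable[ℱ t] fun ω => (state orc (fun i => w i ω) t).count e := by
  induction t with
  | zero => exact ⟨fun e => measurable_const, fun e => measurable_const⟩
  | succ t ih =>
    have hle := ℱ.mono (Nat.le_succ t)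
    have hest := fun e => (ih.1 e).mono hle le_rfl
    have hcount := fun e => (ih.2 e).mono hle le_rfl
    have hw' := fun e => (measurable_pi_apply e).comp (hw (t + 1))
    let _ : MeasurableSpace Ω := ℱ (t + 1)
    have hset := fun e => measurableSet_mem_nextSolution
      (measurableSet_nextSolution_eq_of_state horacle hest hcount) e
    by_cases h : (state orc (0 : ℕ → Fin L → ℝ) t).InInit
    · have h' := fun ω => (inInit_congr (orc := orc) (fun i => w i ω) 0 t).2 h
      simp only [state, step_of_inInit (h' _)]
      exact ⟨fun e => Measurable.ite (hset e) (hw' e) (hest e), hcount⟩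
    · have h' := fun ω => mt (inInit_congr (orc := orc) (fun i => w i ω) 0 t).1 h
      simp only [state, step_of_not_inInit (h' _)]
      have hcast : ∀ e, Measurable fun ω =>
          (((state orc (fun i => w i ω) t).count e : ℕ) : ℝ) := fun e =>
        measurable_from_top.comp (hcount e)
      exact ⟨fun e => Measurable.ite (hset e)
          ((((hcast e).mul (hest e)).add (hw' e)).div ((hcast e).add_const 1)) (hest e),
        fun e => Measurable.ite (hset e) ((hcount e).add_const 1) (hcount e)⟩

/-! ### Concentration of the estimates -/

open Classical in
/-- The exponential process of the estimation error of item `e`, started at `1` until the item is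
observed for the first time. -/
noncomputable def expProcess (m lam : ℝ) (e : Fin L) (s : State L) : ENNReal :=
  if s.u e = 1 then 1 else
    ENNReal.ofReal (Real.exp (lam * (s.count e * (s.est e - m)) - s.count e * (lam ^ 2 / 8)))

/-- The initialization overwrites estimates and keeps the counter at `1`, so an observation restarts
the process instead of multiplying it. -/
theorem expProcess_succ_of_inInit (m lam : ℝ) (e : Fin L) {w : ℕ → Fin L → ℝ} {t : ℕ}
    (h : (state orc w t).InInit) :
    expProcess m lam e (state orc w (t + 1)) =
      if e ∈ nextSolution orc w t then
        ENNReal.ofReal (Real.exp (lam * (w (t + 1) e - m) - lam ^ 2 / 8))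
      else expProcess m lam e (state orc w t) := by
  simp only [expProcess, state, step_of_inInit h, ← nextSolution.eq_def]
  split_ifs with h1 h2 <;> simp_all [count_of_inInit w t h]

/-- `count * (est - m)` is a centred sum, to which an observation adds one term. -/
theorem expProcess_succ_of_not_inInit (m lam : ℝ) (e : Fin L) {w : ℕ → Fin L → ℝ} {t : ℕ}
    (h : ¬ (state orc w t).InInit) :
    expProcess m lam e (state orc w (t + 1)) =
      if e ∈ nextSolution orc w t then
        expProcess m lam e (state orc w t) *
          ENNReal.ofReal (Real.exp (lam * (w (t + 1) e - m) - lam ^ 2 / 8))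
      else expProcess m lam e (state orc w t) := by
  have hu : (state orc w t).u e ≠ 1 := fun he => h ⟨e, he⟩
  simp only [expProcess, state, step_of_not_inInit h, ← nextSolution.eq_def, hu, if_false]
  split_ifs with h1
  · rw [← ENNReal.ofReal_mul (Real.exp_pos _).le, ← Real.exp_add]
    congr 2
    have : ((state orc w t).count e : ℝ) + 1 ≠ 0 := by positivity
    push_cast
    field_simp
    ring
  · rfl

variable {B : SemiBandit L} {mΩ : MeasurableSpace Ω} {μ : Measure Ω} {ℱ : Filtration ℕ mΩ}
  {w : ℕ → Ω → Fin L → ℝ}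

theorem measurable_expProcess (horacle : IsOracle B.feasible orc)
    (hadapted : ∀ t, Measurable[ℱ t] (w t)) (m lam : ℝ) (e : Fin L) (t : ℕ) :
    Measurable[ℱ t] fun ω => expProcess m lam e (state orc (fun i => w i ω) t) := by
  obtain ⟨hest, hcount⟩ := measurable_state (orc := orc) horacle ℱ hadapted t
  let _ : MeasurableSpace Ω := ℱ t
  simp only [expProcess, fun ω => state_u_congr (orc := orc) (fun i => w i ω) 0 t]
  split_ifs
  · exact measurable_const
  · have h1 := hest e
    have h2 : Measurable fun ω => (((state orc (fun i => w i ω) t).count e : ℕ) : ℝ) :=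
      measurable_from_top.comp (hcount e)
    fun_prop

theorem measurableSet_nextSolution_eq (horacle : IsOracle B.feasible orc)
    (hadapted : ∀ t, Measurable[ℱ t] (w t)) (t : ℕ) (A : Finset (Fin L)) :
    MeasurableSet[ℱ t] {ω | nextSolution orc (fun i => w i ω) t = A} := by
  obtain ⟨hest, hcount⟩ := measurable_state (orc := orc) horacle ℱ hadapted t
  let _ : MeasurableSpace Ω := ℱ t
  exact measurableSet_nextSolution_eq_of_state horacle hest hcount A

/-- A supermartingale argument. In the initialization the choice is deterministic and a restarted
process has mean at most `1`; in the main phase the new factor is independent of the past. -/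
theorem lintegral_expProcess_le_one (horacle : IsOracle B.feasible orc)
    [IsProbabilityMeasure μ] (hadapted : ∀ t, Measurable[ℱ t] (w t))
    (hindep : ∀ t, Indep (MeasurableSpace.comap (w (t + 1)) inferInstance) (ℱ t) μ)
    (hlaw : ∀ t, μ.map (w t) = B.P) (lam : ℝ) (e : Fin L) (t : ℕ) :
    ∫⁻ ω, expProcess (B.mean e) lam e (state orc (fun i => w i ω) t) ∂μ ≤ 1 := by
  have hmeas : ∀ t, Measurable (w t) := fun t => (hadapted t).mono (ℱ.le t) le_rfl
  let Y : (Fin L → ℝ) → ENNReal := fun v =>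
    ENNReal.ofReal (Real.exp (lam * (v e - B.mean e) - lam ^ 2 / 8))
  have hYmeas : Measurable Y := by
    have := measurable_pi_apply (X := fun _ : Fin L => ℝ) e
    fun_prop
  have hY : ∀ t, ∫⁻ ω, Y (w t ω) ∂μ ≤ 1 := fun t => by
    rw [← lintegral_map hYmeas (hmeas t), hlaw]
    exact B.lintegral_exp_le_one e lam
  have hX := measurable_expProcess horacle hadapted (B.mean e) lam e
  induction t with
  | zero => simp [expProcess, state, State.start]
  | succ t ih =>
    by_cases h : (state orc (0 : ℕ → Fin L → ℝ) t).InInit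
    · have h' := fun ω => (inInit_congr (orc := orc) (fun i => w i ω) 0 t).2 h
      simp only [expProcess_succ_of_inInit _ _ _ (h' _), nextSolution, choice_of_inInit (h' _),
        fun ω => state_u_congr (orc := orc) (fun i => w i ω) 0 t]
      split_ifs
      · exact hY (t + 1)
      · exact ih
    · have h' := fun ω => mt (inInit_congr (orc := orc) (fun i => w i ω) 0 t).1 h
      simp only [expProcess_succ_of_not_inInit _ _ _ (h' _)]
      have hS : MeasurableSet[ℱ t] {ω | e ∈ nextSolution orc (fun i => w i ω) t} := by
        have h := measurableSet_nextSolution_eq (orc := orc) horacle hadapted t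
        let _ : MeasurableSpace Ω := ℱ t
        exact measurableSet_mem_nextSolution h e
      set S := {ω | e ∈ nextSolution orc (fun i => w i ω) t} with hSdef
      set X := fun ω => expProcess (B.mean e) lam e (state orc (fun i => w i ω) t)
      have hS' := ℱ.le t _ hS
      have hX' : Measurable X := (hX t).mono (ℱ.le t) le_rfl
      -- Both `S` and `X` belong to `ℱ t`, so the first product integrates to a product.
      calc _ = ∫⁻ ω, S.indicator X ω * Y (w (t + 1) ω) + Sᶜ.indicator X ω ∂μ := by
            refine lintegral_congr fun ω => ?_
            by_cases hω : ω ∈ S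
            · have : e ∈ nextSolution orc (fun i => w i ω) t := hω
              simp [hω, this, X, Y]
            · have : e ∉ nextSolution orc (fun i => w i ω) t := hω
              simp [hω, this, X]
        _ = (∫⁻ ω, S.indicator X ω ∂μ) * (∫⁻ ω, Y (w (t + 1) ω) ∂μ) +
              ∫⁻ ω, Sᶜ.indicator X ω ∂μ := by
            rw [lintegral_add_right _ (hX'.indicator hS'.compl),
              lintegral_mul_eq_lintegral_mul_lintegral_of_independent_measurableSpace
                (f := S.indicator X) (g := fun ω => Y (w (t + 1) ω)) (ℱ.le t)
                (hmeas (t + 1)).comap_le (hindep t).symm ((hX t).indicator hS)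
                (hYmeas.comp (comap_measurable _))]
        _ ≤ (∫⁻ ω, S.indicator X ω ∂μ) * 1 + ∫⁻ ω, Sᶜ.indicator X ω ∂μ := by
            gcongr
            exact hY _
        _ = ∫⁻ ω, X ω ∂μ := by
            rw [mul_one, lintegral_indicator hS', lintegral_indicator hS'.compl,
              lintegral_add_compl _ hS']
        _ ≤ 1 := ih

end CombUCB1

/-! ### Tail bounds for the estimates -/

namespace CombUCB1

variable {L : ℕ} {orc : (Fin L → ℝ) → Finset (Fin L)} {Ω : Type*}
  {B : SemiBandit L} {mΩ : MeasurableSpace Ω} {μ : Measure Ω} {ℱ : Filtration ℕ mΩ}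
  {w : ℕ → Ω → Fin L → ℝ}

/-- The probability that an estimate from `s` observations deviates, in the direction `σ`, by at
least the radius of its confidence interval. -/
theorem measureReal_deviation_le (horacle : IsOracle B.feasible orc)
    [IsProbabilityMeasure μ] (hadapted : ∀ t, Measurable[ℱ t] (w t))
    (hindep : ∀ t, Indep (MeasurableSpace.comap (w (t + 1)) inferInstance) (ℱ t) μ)
    (hlaw : ∀ t, μ.map (w t) = B.P) (e : Fin L) {s t : ℕ} (hs : 1 ≤ s) (ht : 1 ≤ t)
    {σ : ℝ} (hσ : σ ^ 2 = 1) :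
    μ.real {ω | ¬ (state orc (fun i => w i ω) t).InInit ∧
      (state orc (fun i => w i ω) t).count e = s ∧
      radius t s ≤ σ * ((state orc (fun i => w i ω) t).est e - B.mean e)} ≤
      1 / (t : ℝ) ^ 3 := by
  have hs' : (0 : ℝ) < s := by exact_mod_cast hs
  have ht' : (0 : ℝ) < t := by exact_mod_cast ht
  have hlog : 0 ≤ Real.log t := Real.log_natCast_nonneg t
  have hc : (s : ℝ) * radius t s ^ 2 = 1.5 * Real.log t := by
    rw [radius, Real.sq_sqrt (by positivity)]
    field_simp
  set c := radius t s
  have hc0 : 0 ≤ c := radius_nonneg t s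
  -- `4 * c` maximizes `lam * s * c - s * lam ^ 2 / 8`; the maximum `2 * s * c ^ 2 = 3 * log t`
  -- gives the level `t ^ 3`.
  have hmarkov := mul_meas_ge_le_lintegral₀ (μ := μ)
    (measurable_expProcess (ℱ := ℱ) horacle hadapted (B.mean e) (σ * (4 * c)) e t
      |>.mono (ℱ.le t) le_rfl).aemeasurable (ENNReal.ofReal ((t : ℝ) ^ 3))
  have hle := hmarkov.trans
    (lintegral_expProcess_le_one (ℱ := ℱ) horacle hadapted hindep hlaw (σ * (4 * c)) e t)
  rw [le_div_iff₀' (by positivity)]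
  have hreal := ENNReal.toReal_mono ENNReal.one_ne_top hle
  rw [ENNReal.toReal_mul, ENNReal.toReal_ofReal (by positivity), ENNReal.toReal_one] at hreal
  refine le_trans ?_ hreal
  refine mul_le_mul_of_nonneg_left (measureReal_mono ?_ ) (by positivity)
  rintro ω ⟨hinit, hcount, hdev⟩
  have hu : (state orc (fun i => w i ω) t).u e ≠ 1 := fun h => hinit ⟨e, h⟩
  simp only [Set.mem_ofPred_eq, expProcess, if_neg hu, hcount]
  refine ENNReal.ofReal_le_ofReal ?_
  have hpow : (t : ℝ) ^ 3 = Real.exp (3 * Real.log t) := by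
    rw [mul_comm, Real.exp_mul, Real.exp_log ht']
    norm_cast
  rw [hpow]
  refine Real.exp_le_exp.2 ?_
  have h1 := mul_le_mul_of_nonneg_left hdev (show 0 ≤ 4 * c * s by positivity)
  have h2 : (σ * (4 * c)) ^ 2 = 16 * c ^ 2 := by
    rw [mul_pow, hσ]
    ring
  rw [h2]
  nlinarith

theorem measureReal_not_concentrated_le (horacle : IsOracle B.feasible orc)
    [IsProbabilityMeasure μ] (hadapted : ∀ t, Measurable[ℱ t] (w t))
    (hindep : ∀ t, Indep (MeasurableSpace.comap (w (t + 1)) inferInstance) (ℱ t) μ)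
    (hlaw : ∀ t, μ.map (w t) = B.P) (t : ℕ) :
    μ.real {ω | ¬ (state orc (fun i => w i ω) t).InInit ∧
      ¬ Concentrated orc B.mean (fun i => w i ω) t} ≤ 2 * L * (1 / (t : ℝ) ^ 2) := by
  rcases t with _ | t
  -- Here the right side is `0`, since `1 / 0 = 0`. The event is empty: any item puts time `0` in
  -- the initialization, and without items concentration is vacuous.
  · have : {ω | ¬ (state orc (fun i => w i ω) 0).InInit ∧
        ¬ Concentrated orc B.mean (fun i => w i ω) 0} = ∅ := by
      ext ω
      simp only [Set.mem_ofPred_eq, Set.mem_empty_iff_false, iff_false, not_and, not_not]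
      exact fun h e => absurd (inInit_zero _ e) h
    rw [this]
    simp
  · let S : Fin L → ℕ → ℝ → Set Ω := fun e s σ =>
      {ω | ¬ (state orc (fun i => w i ω) (t + 1)).InInit ∧
        (state orc (fun i => w i ω) (t + 1)).count e = s ∧
        radius (t + 1) s ≤ σ * ((state orc (fun i => w i ω) (t + 1)).est e - B.mean e)}
    have hS : ∀ e, ∀ s ∈ Finset.Icc 1 (t + 1), μ.real (S e s 1 ∪ S e s (-1)) ≤
        2 * (1 / ((t + 1 : ℕ) : ℝ) ^ 3) := fun e s hs => by
      have hs := (Finset.mem_Icc.1 hs).1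
      have h1 := measureReal_deviation_le (ℱ := ℱ) horacle hadapted hindep hlaw e hs
        (Nat.le_add_left 1 t) (σ := 1) (by norm_num)
      have h2 := measureReal_deviation_le (ℱ := ℱ) horacle hadapted hindep hlaw e hs
        (Nat.le_add_left 1 t) (σ := -1) (by norm_num)
      exact (measureReal_union_le _ _).trans ((add_le_add h1 h2).trans_eq (by ring))
    -- The counter is random, so all its `t + 1` possible values are included; this costs one power
    -- of the cubic tail.
    calc _ ≤ μ.real (⋃ e ∈ (Finset.univ : Finset (Fin L)), ⋃ s ∈ Finset.Icc 1 (t + 1),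
          (S e s 1 ∪ S e s (-1))) := by
          refine measureReal_mono ?_ (measure_ne_top _ _)
          rintro ω ⟨hinit, hconc⟩
          simp only [Concentrated, not_forall, not_le] at hconc
          obtain ⟨e, he⟩ := hconc
          simp only [Set.mem_iUnion]
          refine ⟨e, Finset.mem_univ e, (state orc (fun i => w i ω) (t + 1)).count e,
            Finset.mem_Icc.2 ⟨one_le_count _ (t + 1) e, count_succ_le _ t e⟩, ?_⟩
          rcases lt_abs.1 he with h | h
          · exact Or.inl ⟨hinit, rfl, by linarith⟩
          · exact Or.inr ⟨hinit, rfl, by linarith⟩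
      _ ≤ ∑ e : Fin L, ∑ s ∈ Finset.Icc 1 (t + 1), μ.real (S e s 1 ∪ S e s (-1)) :=
          (measureReal_biUnion_finset_le _ _).trans
            (Finset.sum_le_sum fun e _ => measureReal_biUnion_finset_le _ _)
      _ ≤ ∑ e : Fin L, ∑ s ∈ Finset.Icc 1 (t + 1), 2 * (1 / ((t + 1 : ℕ) : ℝ) ^ 3) :=
          Finset.sum_le_sum fun e _ => Finset.sum_le_sum fun s hs => hS e s hs
      _ = 2 * L * (1 / ((t + 1 : ℕ) : ℝ) ^ 2) := by
          simp only [Finset.sum_const, Finset.card_univ, Fintype.card_fin, Nat.card_Icc,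
            nsmul_eq_mul]
          push_cast
          field_simp

/-! ### The expected regret -/

theorem integrable_payoff_comp {v : Ω → Fin L → ℝ} (hmeas : Measurable v)
    (hlaw : μ.map v = B.P) (A : Finset (Fin L)) : Integrable (fun ω => payoff A (v ω)) μ := by
  have h : Integrable (payoff A) (μ.map v) := by
    rw [hlaw]
    exact integrable_finsetSum _ fun e _ => B.integrable_eval e
  exact h.comp_measurable hmeas

theorem integral_payoff_comp {v : Ω → Fin L → ℝ} (hmeas : Measurable v)
    (hlaw : μ.map v = B.P) (A : Finset (Fin L)) :
    ∫ ω, payoff A (v ω) ∂μ = payoff A B.mean := by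
  rw [← B.integral_payoff, ← hlaw, integral_map hmeas.aemeasurable]
  exact (Finset.measurable_sum A fun e _ => measurable_pi_apply e).aestronglyMeasurable

/-- The choice has finitely many values; this reduces integrals involving it to a fixed `A`. -/
theorem sum_indicator_nextSolution (F : Finset (Fin L) → Ω → ℝ) (t : ℕ) :
    (fun ω => F (nextSolution orc (fun i => w i ω) t) ω) = fun ω =>
      ∑ A, {ω | nextSolution orc (fun i => w i ω) t = A}.indicator (F A) ω := by
  funext ω
  simp [Set.indicator_apply]

theorem integrable_nextSolution (horacle : IsOracle B.feasible orc)
    (hadapted : ∀ t, Measurable[ℱ t] (w t)) {F : Finset (Fin L) → Ω → ℝ}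
    (hF : ∀ A, Integrable (F A) μ) (t : ℕ) :
    Integrable (fun ω => F (nextSolution orc (fun i => w i ω) t) ω) μ := by
  rw [sum_indicator_nextSolution]
  exact integrable_finsetSum _ fun A _ => (hF A).indicator
    (ℱ.le t _ (measurableSet_nextSolution_eq horacle hadapted t A))

/-- The choice at time `t + 1` is independent of the weights at that time. -/
theorem integral_payoff_nextSolution (horacle : IsOracle B.feasible orc)
    [IsProbabilityMeasure μ] (hadapted : ∀ t, Measurable[ℱ t] (w t))
    (hindep : ∀ t, Indep (MeasurableSpace.comap (w (t + 1)) inferInstance) (ℱ t) μ)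
    (hlaw : ∀ t, μ.map (w t) = B.P) (t : ℕ) :
    ∫ ω, payoff (nextSolution orc (fun i => w i ω) t) (w (t + 1) ω) ∂μ =
      ∫ ω, payoff (nextSolution orc (fun i => w i ω) t) B.mean ∂μ := by
  have hmeas : Measurable (w (t + 1)) := (hadapted _).mono (ℱ.le _) le_rfl
  have hint := integrable_payoff_comp hmeas (hlaw (t + 1))
  have hset := measurableSet_nextSolution_eq (ℱ := ℱ) (w := w) horacle hadapted t
  have h1 := sum_indicator_nextSolution (orc := orc) (w := w)
    (fun A ω => payoff A (w (t + 1) ω)) t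
  have h2 := sum_indicator_nextSolution (orc := orc) (w := w)
    (fun A _ => payoff A B.mean) t
  rw [h1, h2, integral_finsetSum _ fun A _ => (hint A).indicator (ℱ.le t _ (hset A)),
    integral_finsetSum _ fun A _ => (integrable_const _).indicator (ℱ.le t _ (hset A))]
  refine Finset.sum_congr rfl fun A _ => ?_
  rw [integral_indicator (ℱ.le t _ (hset A)), integral_indicator (ℱ.le t _ (hset A)),
    ← setIntegral_condExp (ℱ.le t) (hint A) (hset A)]
  have hpay : Measurable (payoff A) := Finset.measurable_sum A fun e _ => measurable_pi_apply e
  -- By independence, conditioning on `ℱ t` replaces the new return by its mean.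
  have hcond := condExp_indep_eq hmeas.comap_le (ℱ.le t)
    (hpay.comp (comap_measurable (w (t + 1)))).stronglyMeasurable (hindep t)
  refine setIntegral_congr_ae (ℱ.le t _ (hset A)) (hcond.mono fun ω hω _ => ?_)
  exact hω.trans (integral_payoff_comp hmeas (hlaw (t + 1)) A)

theorem integrable_cumulativeRegret (horacle : IsOracle B.feasible orc)
    (hadapted : ∀ t, Measurable[ℱ t] (w t)) (hlaw : ∀ t, μ.map (w t) = B.P)
    (Astar : Finset (Fin L)) (n : ℕ) :
    Integrable (fun ω => cumulativeRegret orc Astar (fun t => w t ω) n) μ := by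
  have hint := fun t => integrable_payoff_comp ((hadapted t).mono (ℱ.le t) le_rfl) (hlaw t)
  exact integrable_finsetSum _ fun t _ => (hint _ _).sub
    (integrable_nextSolution horacle hadapted (hint (t + 1)) t)

theorem integral_cumulativeRegret (horacle : IsOracle B.feasible orc)
    [IsProbabilityMeasure μ] (hadapted : ∀ t, Measurable[ℱ t] (w t))
    (hindep : ∀ t, Indep (MeasurableSpace.comap (w (t + 1)) inferInstance) (ℱ t) μ)
    (hlaw : ∀ t, μ.map (w t) = B.P) (Astar : Finset (Fin L)) (n : ℕ) :
    ∫ ω, cumulativeRegret orc Astar (fun t => w t ω) n ∂μ =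
      ∫ ω, ∑ t ∈ Finset.range n,
        B.gap Astar (nextSolution orc (fun i => w i ω) t) ∂μ := by
  have hmeas : ∀ t, Measurable (w t) := fun t => (hadapted t).mono (ℱ.le t) le_rfl
  have hint := fun t => integrable_payoff_comp (hmeas t) (hlaw t)
  have hnext := fun t => integrable_nextSolution (μ := μ) horacle hadapted (hint (t + 1)) t
  have hmean := fun t => integrable_nextSolution (μ := μ) horacle hadapted
    (F := fun A _ => payoff A B.mean) (fun A => integrable_const _) t
  have hsub : ∀ t, Integrable (fun ω => payoff Astar (w (t + 1) ω) -
      payoff (nextSolution orc (fun i => w i ω) t) (w (t + 1) ω)) μ := fun t =>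
    (hint _ _).sub (hnext t)
  have hsub' : ∀ t, Integrable (fun ω => payoff Astar B.mean -
      payoff (nextSolution orc (fun i => w i ω) t) B.mean) μ := fun t =>
    (integrable_const _).sub (hmean t)
  unfold cumulativeRegret SemiBandit.gap
  rw [integral_finsetSum _ fun t _ => hsub t, integral_finsetSum _ fun t _ => hsub' t]
  refine Finset.sum_congr rfl fun t _ => ?_
  rw [integral_sub (hint _ _) (hnext t), integral_sub (integrable_const _) (hmean t),
    integral_payoff_nextSolution horacle hadapted hindep hlaw,
    integral_payoff_comp (hmeas _) (hlaw _)]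
  simp

-- Splits times into initialization, concentrated and bad ones; the first and last kinds cost at
-- most `K` each.
open Classical in
theorem sum_gap_le (horacle : IsOracle B.feasible orc)
    (hcover : ∀ e : Fin L, ∃ A ∈ B.feasible, e ∈ A) {Astar : Finset (Fin L)}
    (hstar : Astar ∈ B.feasible) {Δ : ℝ} (hΔ : 0 < Δ)
    (hgap : ∀ A ∈ B.feasible, 0 < B.gap Astar A → B.gap Astar A = Δ)
    (v : ℕ → Fin L → ℝ) (n : ℕ) :
    ∑ t ∈ Finset.range n, B.gap Astar (nextSolution orc v t) ≤
      48 * B.maxCard * L * Real.log n / Δ + B.maxCard * L + ∑ t ∈ Finset.range n,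
        if ¬ (state orc v t).InInit ∧ ¬ Concentrated orc B.mean v t then
          (B.maxCard : ℝ) else 0 := by
  have hgood := sum_gap_concentrated_le B hstar hΔ hgap horacle v n
  have hinit : (∑ t ∈ Finset.range n, if (state orc v t).InInit then (B.maxCard : ℝ) else 0) ≤
      B.maxCard * L := by
    rw [← Finset.sum_filter, Finset.sum_const, nsmul_eq_mul, mul_comm]
    gcongr
    exact card_inInit_le horacle hcover v n
  refine le_trans ?_ (add_le_add_left (add_le_add hgood hinit) _)
  rw [← Finset.sum_add_distrib, ← Finset.sum_add_distrib]
  refine Finset.sum_le_sum fun t _ => ?_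
  have := B.gap_le_maxCard hstar (nextSolution orc v t)
  by_cases h1 : (state orc v t).InInit <;> by_cases h2 : Concentrated orc B.mean v t <;>
    simp [h1, h2, this]

theorem measurableSet_not_concentrated (horacle : IsOracle B.feasible orc)
    (hadapted : ∀ t, Measurable[ℱ t] (w t)) (t : ℕ) :
    MeasurableSet {ω | ¬ (state orc (fun i => w i ω) t).InInit ∧
      ¬ Concentrated orc B.mean (fun i => w i ω) t} := by
  obtain ⟨hest, hcount⟩ := measurable_state (orc := orc) horacle ℱ hadapted t
  simp only [fun ω => inInit_congr (orc := orc) (fun i => w i ω) 0 t]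
  refine (MeasurableSet.const _).inter (MeasurableSet.compl ?_)
  have : {ω | Concentrated orc B.mean (fun i => w i ω) t} =
      ⋂ e, {ω | |(state orc (fun i => w i ω) t).est e - B.mean e| ≤
        radius t ((state orc (fun i => w i ω) t).count e)} := by
    ext ω
    simp [Concentrated]
  change MeasurableSet {ω | Concentrated orc B.mean (fun i => w i ω) t}
  rw [this]
  refine MeasurableSet.iInter fun e => measurableSet_le ?_ ?_
  · exact (((hest e).mono (ℱ.le t) le_rfl).sub_const _).abs
  · exact (measurable_from_top (f := radius t)).comp ((hcount e).mono (ℱ.le t) le_rfl)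

theorem integral_sum_gap_le (horacle : IsOracle B.feasible orc)
    (hcover : ∀ e : Fin L, ∃ A ∈ B.feasible, e ∈ A) {Astar : Finset (Fin L)}
    (hstar : Astar ∈ B.feasible) {Δ : ℝ} (hΔ : 0 < Δ)
    (hgap : ∀ A ∈ B.feasible, 0 < B.gap Astar A → B.gap Astar A = Δ)
    [IsProbabilityMeasure μ] (hadapted : ∀ t, Measurable[ℱ t] (w t))
    (hindep : ∀ t, Indep (MeasurableSpace.comap (w (t + 1)) inferInstance) (ℱ t) μ)
    (hlaw : ∀ t, μ.map (w t) = B.P) (n : ℕ) :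
    ∫ ω, ∑ t ∈ Finset.range n, B.gap Astar (nextSolution orc (fun i => w i ω) t) ∂μ ≤
      48 * B.maxCard * L * Real.log n / Δ + (Real.pi ^ 2 / 3 + 1) * B.maxCard * L := by
  classical
  let bad : ℕ → Set Ω := fun t => {ω | ¬ (state orc (fun i => w i ω) t).InInit ∧
    ¬ Concentrated orc B.mean (fun i => w i ω) t}
  have hbad : ∀ t, MeasurableSet (bad t) := measurableSet_not_concentrated horacle hadapted
  have hind : ∀ t, Integrable ((bad t).indicator fun _ => (B.maxCard : ℝ)) μ := fun t =>
    (integrable_const _).indicator (hbad t)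
  calc _ ≤ ∫ ω, (48 * B.maxCard * L * Real.log n / Δ + B.maxCard * L +
        ∑ t ∈ Finset.range n, (bad t).indicator (fun _ => (B.maxCard : ℝ)) ω) ∂μ := by
        refine integral_mono (integrable_finsetSum _ fun t _ =>
          integrable_nextSolution (F := fun A _ => B.gap Astar A) horacle hadapted
            (fun A => integrable_const _) t)
          ((integrable_const _).add (integrable_finsetSum _ fun t _ => hind t)) fun ω => ?_
        refine (sum_gap_le horacle hcover hstar hΔ hgap (fun i => w i ω) n).trans_eq ?_
        simp only [Set.indicator_apply, bad, Set.mem_ofPred_eq]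
    _ = 48 * B.maxCard * L * Real.log n / Δ + B.maxCard * L +
        ∑ t ∈ Finset.range n, μ.real (bad t) * B.maxCard := by
        rw [integral_add (integrable_const _) (integrable_finsetSum _ fun t _ => hind t),
          integral_finsetSum _ fun t _ => hind t]
        simp [integral_indicator_const _ (hbad _)]
    _ ≤ 48 * B.maxCard * L * Real.log n / Δ + B.maxCard * L +
        ∑ t ∈ Finset.range n, 2 * L * (1 / (t : ℝ) ^ 2) * B.maxCard := by
        gcongr with t
        exact measureReal_not_concentrated_le horacle hadapted hindep hlaw t
    _ = 48 * B.maxCard * L * Real.log n / Δ + B.maxCard * L +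
        2 * L * (∑ t ∈ Finset.range n, 1 / (t : ℝ) ^ 2) * B.maxCard := by
        rw [Finset.mul_sum, Finset.sum_mul]
    _ ≤ 48 * B.maxCard * L * Real.log n / Δ + B.maxCard * L +
        2 * L * (Real.pi ^ 2 / 6) * B.maxCard := by
        gcongr
        exact sum_le_hasSum _ (fun t _ => by positivity) hasSum_zeta_two
    _ = _ := by ring

end CombUCB1

theorem mainTheorem7 {L : ℕ} (B : SemiBandit L)
    (hcover : ∀ e : Fin L, ∃ A ∈ B.feasible, e ∈ A)
    (Astar : Finset (Fin L)) (hstar : B.IsOptimal Astar)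
    (Δ : ℝ) (hΔ : 0 < Δ)
    (hgap : ∀ A ∈ B.feasible, 0 < B.gap Astar A → B.gap Astar A = Δ)
    (oracle : (Fin L → ℝ) → Finset (Fin L)) (horacle : IsOracle B.feasible oracle)
    {Ω : Type*} [MeasurableSpace Ω] (μ : Measure Ω) [IsProbabilityMeasure μ]
    (w : ℕ → Ω → Fin L → ℝ) (hmeas : ∀ t, Measurable (w t))
    (hindep : iIndepFun w μ) (hlaw : ∀ t, μ.map (w t) = B.P) (n : ℕ) :
    Integrable (fun ω => CombUCB1.cumulativeRegret oracle Astar (fun t => w t ω) n) μ ∧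
      ∫ ω, CombUCB1.cumulativeRegret oracle Astar (fun t => w t ω) n ∂μ ≤
        (B.maxCard : ℝ) ^ ((4 : ℝ) / 3) * L * (48 / Δ) * Real.log n +
          (Real.pi ^ 2 / 3 + 1) * B.maxCard * L := by
  have hsm := fun t => (hmeas t).stronglyMeasurable
  let ℱ := Filtration.natural w hsm
  have hadapted : ∀ t, Measurable[ℱ t] (w t) := fun t =>
    (Filtration.stronglyAdapted_natural hsm t).measurable
  have hind : ∀ t, Indep (MeasurableSpace.comap (w (t + 1)) inferInstance) (ℱ t) μ := fun t =>
    hindep.indep_comap_natural_of_lt hsm (Nat.lt_succ_self t)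
  refine ⟨CombUCB1.integrable_cumulativeRegret (ℱ := ℱ) horacle hadapted hlaw Astar n, ?_⟩
  rw [CombUCB1.integral_cumulativeRegret (ℱ := ℱ) horacle hadapted hind hlaw]
  refine (CombUCB1.integral_sum_gap_le (ℱ := ℱ) horacle hcover hstar.1 hΔ hgap hadapted hind
    hlaw n).trans ?_
  -- The bound obtained is linear in `K`; the larger power dominates because `K` is `0` or at least
  -- `1`.
  have hK : (B.maxCard : ℝ) ≤ (B.maxCard : ℝ) ^ ((4 : ℝ) / 3) := by
    rcases Nat.eq_zero_or_pos B.maxCard with h | h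
    · rw [h, Nat.cast_zero]
      exact Real.rpow_nonneg le_rfl _
    · exact Real.self_le_rpow_of_one_le (by exact_mod_cast h) (by norm_num)
  have hlog : 0 ≤ Real.log n := Real.log_natCast_nonneg n
  gcongr
  calc 48 * (B.maxCard : ℝ) * L * Real.log n / Δ = B.maxCard * L * (48 / Δ) * Real.log n := by
        ring
    _ ≤ _ := by gcongr
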